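/- Let $\ell$ be an odd prime, and let $\mathcal G$ be the poset of isomorphism classes of finite abelian $\ell$-groups, where $A\le B$ if and only if there is an injective homomorphism $A\hookrightarrow B$. For $A,C\in\mathcal G$ let $\operatorname{sub}(A,C)$ be the number of subgroups of $C$ isomorphic to $A$, and let $\operatorname{rank}A=\dim_{\mathbb F_\ell}(A/\ell A)$. An $A$-chain is a finite linearly ordered subset $\mathfrak C=\{A_1<\dots<A_i\}$ of $\{B\in\mathcal G : B>A\}$; for a nonempty $A$-chain put $$\operatorname{sub}(\mathfrak C)=(-1)^i\operatorname{sub}(A,A_1)\prod_{j=1}^{i-1}\operatorname{sub}(A_j,A_{j+1}).$$ Define $S(A,C)=0$ if $A\not\le C$, $S(A,C)=1$ if $A=C$, and $$S(A,C)=\sum_{\substack{A\text{-chains }\mathfrak C\\ \max\mathfrak C=C}}\operatorname{sub}(\mathfrak C)\qquad\text{if }A<C.$$ **Theorem.** Suppose that $A,C\in\mathcal G$, that $\operatorname{rank}A=\operatorname{rank}C=r$, and that there is no injective homomorphism $\iota:A\hookrightarrow C$ whose cokernel is elementary abelian (i.e. killed by $\ell$; the trivial group counts as elementary abelian). Then $S(A,C)=0$.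 -/

import Mathlib

universe u

/-- A finite abelian `ℓ`-group (written additively). -/
structure FinAbLGroup (ℓ : ℕ) where
  carrier : Type u
  [addCommGroup : AddCommGroup carrier]
  [finite : Finite carrier]
  isLGroup : IsPGroup ℓ (Multiplicative carrier)

namespace FinAbLGroup

variable {ℓ : ℕ}

instance : CoeSort (FinAbLGroup.{u} ℓ) (Type u) := ⟨carrier⟩

attribute [instance] addCommGroup finite

/-- A subgroup of a finite abelian `ℓ`-group, as a finite abelian `ℓ`-group. -/
def ofSubgroup (C : FinAbLGroup.{u} ℓ) (H : AddSubgroup C) : FinAbLGroup.{u} ℓ where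
  carrier := H
  isLGroup := C.isLGroup.of_injective (AddMonoidHom.toMultiplicative H.subtype)
    H.subtype_injective

/-- Two finite abelian `ℓ`-groups are identified when they are isomorphic. -/
instance isoSetoid (ℓ : ℕ) : Setoid (FinAbLGroup.{u} ℓ) where
  r A B := Nonempty (A ≃+ B)
  iseqv := ⟨fun _ => ⟨AddEquiv.refl _⟩, fun ⟨e⟩ => ⟨e.symm⟩, fun ⟨e⟩ ⟨f⟩ => ⟨e.trans f⟩⟩

/-- There is an injective group homomorphism `A ↪ B`. -/
def Embeds (A B : FinAbLGroup.{u} ℓ) : Prop :=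
  ∃ f : A →+ B, Function.Injective f

/-- The number of subgroups of `C` that are isomorphic to `A`. -/
noncomputable def numSub (A C : FinAbLGroup.{u} ℓ) : ℕ :=
  Nat.card {H : AddSubgroup C // Nonempty (H ≃+ A)}

theorem Embeds.congr {A A' B B' : FinAbLGroup.{u} ℓ} (hA : A ≈ A') (hB : B ≈ B')
    (h : Embeds A B) : Embeds A' B' := by
  obtain ⟨e⟩ := hA
  obtain ⟨e'⟩ := hB
  obtain ⟨f, hf⟩ := h
  exact ⟨(e'.toAddMonoidHom.comp f).comp e.symm.toAddMonoidHom,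
    (e'.injective.comp hf).comp e.symm.injective⟩

theorem numSub_congr {A A' C C' : FinAbLGroup.{u} ℓ} (hA : A ≈ A') (hC : C ≈ C') :
    numSub A C = numSub A' C' := by
  obtain ⟨e⟩ := hA
  obtain ⟨e'⟩ := hC
  refine Nat.card_congr (Equiv.subtypeEquiv e'.mapAddSubgroup.toEquiv fun H => ?_)
  have k : H ≃+ (e'.mapAddSubgroup H : AddSubgroup C') := e'.addSubgroupMap H
  exact ⟨fun ⟨g⟩ => ⟨k.symm.trans (g.trans e)⟩, fun ⟨g⟩ => ⟨k.trans (g.trans e.symm)⟩⟩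

/-- `rank A = dim_{𝔽_ℓ} (A / ℓA)`. -/
noncomputable def rank (A : FinAbLGroup.{u} ℓ) : ℕ :=
  Module.finrank (ZMod ℓ) (ModN A ℓ)

end FinAbLGroup

/-- An abelian group is elementary abelian (for the prime `ℓ`) if it is killed by `ℓ`. -/
def IsElementaryAbelian (ℓ : ℕ) (Q : Type u) [AddCommGroup Q] : Prop :=
  ∀ x : Q, ℓ • x = 0

/-- The set `𝒢` of isomorphism classes of finite abelian `ℓ`-groups. -/
def IsoClass (ℓ : ℕ) : Type (u + 1) := Quotient (FinAbLGroup.isoSetoid.{u} ℓ)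

namespace IsoClass

variable {ℓ : ℕ}

/-- The isomorphism class `[A]`. -/
def of (A : FinAbLGroup.{u} ℓ) : IsoClass.{u} ℓ := Quotient.mk _ A

/-- `[A] ≤ [B]` if and only if there is an injective homomorphism `A ↪ B`. -/
instance : LE (IsoClass.{u} ℓ) where
  le := Quotient.lift₂ FinAbLGroup.Embeds fun _ _ _ _ hA hB =>
    propext ⟨.congr hA hB, .congr (Setoid.symm hA) (Setoid.symm hB)⟩

theorem of_le_of {A B : FinAbLGroup.{u} ℓ} : of A ≤ of B ↔ FinAbLGroup.Embeds A B := Iff.rfl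

instance : PartialOrder (IsoClass.{u} ℓ) where
  le_refl := by
    rintro ⟨A⟩
    exact ⟨AddMonoidHom.id _, Function.injective_id⟩
  le_trans := by
    rintro ⟨A⟩ ⟨B⟩ ⟨C⟩ ⟨f, hf⟩ ⟨g, hg⟩
    exact ⟨g.comp f, hg.comp hf⟩
  le_antisymm := by
    rintro ⟨A⟩ ⟨B⟩ ⟨f, hf⟩ ⟨g, hg⟩
    have h := (Nat.bijective_iff_injective_and_card f).2
      ⟨hf, le_antisymm (Nat.card_le_card_of_injective f hf) (Nat.card_le_card_of_injective g hg)⟩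
    exact Quotient.sound ⟨AddEquiv.ofBijective f h⟩

/-- `sub(A, C)`: the number of subgroups of `C` that are isomorphic to `A`. -/
noncomputable def sub : IsoClass.{u} ℓ → IsoClass.{u} ℓ → ℕ :=
  Quotient.lift₂ FinAbLGroup.numSub fun _ _ _ _ hA hC => FinAbLGroup.numSub_congr hA hC

/-- Every class below `[C]` is the class of a subgroup of `C`, so there are finitely many. -/
theorem finite_Iic (C : IsoClass.{u} ℓ) : (Set.Iic C).Finite := by
  obtain ⟨C⟩ := C
  refine (Set.finite_range fun H : AddSubgroup C => of (C.ofSubgroup H)).subset ?_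
  rintro ⟨A⟩ ⟨f, hf⟩
  exact ⟨f.range, Quotient.sound ⟨(AddMonoidHom.ofInjective hf).symm⟩⟩

/-- An `A`-chain: a finite linearly ordered subset of `{B ∈ 𝒢 | B > A}`. -/
def IsAChain (A : IsoClass.{u} ℓ) (c : Finset (IsoClass.{u} ℓ)) : Prop :=
  (∀ B ∈ c, A < B) ∧ IsChain (· ≤ ·) (c : Set (IsoClass.{u} ℓ))

/-- The `A`-chains with maximum `C`. -/
def chainsTo (A C : IsoClass.{u} ℓ) : Set (Finset (IsoClass.{u} ℓ)) :=
  {c | IsAChain A c ∧ IsGreatest (c : Set (IsoClass.{u} ℓ)) C}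

theorem finite_chainsTo (A C : IsoClass.{u} ℓ) : (chainsTo A C).Finite := by
  refine ((finite_Iic C).toFinset.powerset.finite_toSet).subset fun c hc => ?_
  simp only [Finset.coe_powerset, Set.mem_preimage, Set.mem_powerset_iff, Set.Finite.coe_toFinset]
  exact fun B hB => hc.2.2 hB

open Classical in
/-- The pairs of consecutive elements of `{A} ∪ c`. If `c = {A₁ < ⋯ < Aᵢ}` is an `A`-chain and
`A₀ = A`, these are the pairs `(Aⱼ, Aⱼ₊₁)` with `0 ≤ j < i`. -/
noncomputable def consecutive (A : IsoClass.{u} ℓ) (c : Finset (IsoClass.{u} ℓ)) :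
    Finset (IsoClass.{u} ℓ × IsoClass.{u} ℓ) :=
  {p ∈ insert A c ×ˢ insert A c | p.1 < p.2 ∧ ∀ D ∈ insert A c, ¬ (p.1 < D ∧ D < p.2)}

/-- `sub(c) = (-1)^i sub(A, A₁) ∏_{1 ≤ j < i} sub(Aⱼ, Aⱼ₊₁)` for `c = {A₁ < ⋯ < Aᵢ}`. -/
noncomputable def subChain (A : IsoClass.{u} ℓ) (c : Finset (IsoClass.{u} ℓ)) : ℤ :=
  (-1) ^ c.card * ∏ p ∈ consecutive A c, (sub p.1 p.2 : ℤ)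

open Classical in
/-- The Möbius-type function `S : 𝒢 × 𝒢 → ℤ`. -/
noncomputable def S (A C : IsoClass.{u} ℓ) : ℤ :=
  if ¬ A ≤ C then 0
  else if A = C then 1
  else ∑ c ∈ (finite_chainsTo A C).toFinset, subChain A c

end IsoClass

/-! The number S(A, C) is the sum of the Möbius numbers μ(H, C), in the subgroup lattice of C, over
the subgroups H of C isomorphic to A (`S_eq_sum_moebiusTop`): splitting off the least element of a
chain gives S the recursion that defines μ, summed over an isomorphism class. The subgroup ℓC
consists of non-generators (H + ℓC = C forces H = C), so μ(H, C) = 0 unless H contains ℓC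
(`moebiusTop_eq_zero_of_not_le`). If H ≅ A contains ℓC, then C/H is killed by ℓ, and A ≅ H ⊆ C is an
embedding of the excluded kind. Hence every term vanishes. -/

/-! ### Möbius numbers and non-generators -/

section Moebius

variable {α : Type*} [PartialOrder α] [OrderTop α] [Finite α]

open Classical in
/-- The Möbius number `μ(a, ⊤)` of a finite poset with a greatest element. -/
noncomputable def moebiusTop (a : α) : ℤ :=
  letI := Fintype.ofFinite α
  letI : LocallyFiniteOrder α := Fintype.toLocallyFiniteOrder
  IncidenceAlgebra.mu ℤ a ⊤

theorem moebiusTop_top : moebiusTop (⊤ : α) = 1 := by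
  simp [moebiusTop]

open Classical in
theorem moebiusTop_eq_neg_sum [Fintype α] {a : α} (ha : a ≠ ⊤) :
    moebiusTop a = -∑ x with a < x, moebiusTop x := by
  unfold moebiusTop
  let : LocallyFiniteOrder α := @Fintype.toLocallyFiniteOrder α _ (Fintype.ofFinite α) _ _
  rw [IncidenceAlgebra.mu_eq_neg_sum_Ioc_of_ne ha]
  congr 1
  refine Finset.sum_congr ?_ fun _ _ => rfl
  ext x
  simp

/-- If `f` is a non-generator, in the sense that `a ⊔ f = ⊤` only for `a = ⊤`, then the Möbius
number of any `a` that is not above `f` vanishes. -/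
theorem moebiusTop_eq_zero_of_not_le {α : Type*} [Lattice α] [OrderTop α] [Finite α] {f : α}
    (hf : ∀ a : α, a ⊔ f = ⊤ → a = ⊤) (a : α) (ha : ¬ f ≤ a) : moebiusTop a = 0 := by
  classical
  let := Fintype.ofFinite α
  induction a using WellFoundedGT.induction with
  | ind a ih =>
  have hat : a ≠ ⊤ := fun h => ha (h ▸ le_top)
  have hsup : a ⊔ f ≠ ⊤ := fun h => hat (hf a h)
  -- By induction, only the x above f contribute. Such x ≥ a are automatically different from a,
  -- since f ≰ a.
  have hsplit : ∑ x with a < x, moebiusTop x = ∑ x with a ⊔ f ≤ x, moebiusTop x := by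
    symm
    refine Finset.sum_subset (fun x hx => ?_) fun x hx hx' => ?_
    · simp only [Finset.mem_filter, Finset.mem_univ, true_and, sup_le_iff] at hx ⊢
      exact lt_of_le_of_ne hx.1 fun h => ha (h ▸ hx.2)
    · simp only [Finset.mem_filter, Finset.mem_univ, true_and, sup_le_iff, not_and] at hx hx'
      exact ih x hx (hx' hx.le)
  have hIci : (Finset.univ.filter fun x => a ⊔ f ≤ x) =
      insert (a ⊔ f) (Finset.univ.filter fun x => a ⊔ f < x) := by
    ext x
    simp only [Finset.mem_filter, Finset.mem_univ, true_and, Finset.mem_insert]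
    rw [le_iff_eq_or_lt, eq_comm]
  -- As a ⊔ f ≠ ⊤, the Möbius recursion at a ⊔ f says that the sum over all x ≥ a ⊔ f is zero.
  rw [moebiusTop_eq_neg_sum hat, hsplit, hIci, Finset.sum_insert (by simp),
    moebiusTop_eq_neg_sum hsup]
  simp

end Moebius

/-- In a finite abelian `ℓ`-group, `ℓC` consists of non-generators. -/
theorem AddSubgroup.eq_top_of_sup_range_nsmul_eq_top {ℓ : ℕ} {C : Type*} [AddCommGroup C]
    [Finite C] (hC : IsPGroup ℓ (Multiplicative C)) (H : AddSubgroup C)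
    (h : H ⊔ (nsmulAddMonoidHom (α := C) ℓ).range = ⊤) : H = ⊤ := by
  -- Iterating C = H + ℓC gives C = H + ℓ ^ n C for every n.
  have key : ∀ (n : ℕ) (x : C), ∃ y ∈ H, ∃ z : C, x = y + ℓ ^ n • z := by
    intro n
    induction n with
    | zero => exact fun x => ⟨0, H.zero_mem, x, by simp⟩
    | succ n ih =>
      intro x
      obtain ⟨y, hy, z, rfl⟩ := ih x
      obtain ⟨y', hy', w, ⟨z', rfl⟩, rfl⟩ := AddSubgroup.mem_sup.1 (h ▸ AddSubgroup.mem_top z)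
      refine ⟨y + ℓ ^ n • y', H.add_mem hy (H.nsmul_mem hy' _), z', ?_⟩
      simp [pow_succ, mul_smul, smul_add, add_assoc]
  cases nonempty_fintype C
  choose k hk using fun x : C => hC (Multiplicative.ofAdd x)
  have hk' (x : C) : ℓ ^ k x • x = 0 := hk x
  refine (AddSubgroup.eq_top_iff' H).2 fun x => ?_
  -- The sum of all the exponents k c bounds each one, so this power of ℓ kills C.
  obtain ⟨y, hy, z, rfl⟩ := key (∑ c, k c) x
  obtain ⟨d, hd⟩ := pow_dvd_pow ℓ (Finset.single_le_sum (f := k) (fun _ _ => Nat.zero_le _)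
    (Finset.mem_univ z))
  rw [hd, mul_comm, mul_smul, hk', smul_zero, add_zero]
  exact hy

/-! ### Chains of isomorphism classes and the recursion for S -/

namespace IsoClass

variable {ℓ : ℕ}

theorem finite_extendedChains (A C : IsoClass.{u} ℓ) :
    {c : Finset (IsoClass.{u} ℓ) | IsAChain A c ∧
      IsGreatest (insert A (c : Set (IsoClass.{u} ℓ))) C}.Finite := by
  refine ((finite_Iic C).toFinset.powerset.finite_toSet).subset fun c hc => ?_
  simp only [Finset.coe_powerset, Set.mem_preimage, Set.mem_powerset_iff, Set.Finite.coe_toFinset]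
  exact fun B hB => hc.2.2 (Set.mem_insert_of_mem _ hB)

/-- The `A`-chains `c` such that `C` is the maximum of `{A} ∪ c`. -/
noncomputable def extendedChains (A C : IsoClass.{u} ℓ) : Finset (Finset (IsoClass.{u} ℓ)) :=
  (finite_extendedChains A C).toFinset

theorem mem_extendedChains {A C : IsoClass.{u} ℓ} {c : Finset (IsoClass.{u} ℓ)} :
    c ∈ extendedChains A C ↔
      IsAChain A c ∧ IsGreatest (insert A (c : Set (IsoClass.{u} ℓ))) C := by
  simp [extendedChains]

theorem extendedChains_self (A : IsoClass.{u} ℓ) : extendedChains A A = {∅} := by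
  ext c
  rw [mem_extendedChains, Finset.mem_singleton]
  constructor
  · rintro ⟨h, -, h'⟩
    refine Finset.eq_empty_of_forall_notMem fun B hB => ?_
    exact (h.1 B hB).not_ge (h' (Set.mem_insert_of_mem _ hB))
  · rintro rfl
    simp [IsAChain]

theorem extendedChains_of_lt {A C : IsoClass.{u} ℓ} (h : A < C) :
    extendedChains A C = (finite_chainsTo A C).toFinset := by
  ext c
  rw [mem_extendedChains, Set.Finite.mem_toFinset, chainsTo, Set.mem_ofPred_eq]
  refine and_congr_right fun _ => ⟨fun h' => ?_, fun h' => ?_⟩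
  · refine ⟨h'.1.resolve_left h.ne', fun B hB => h'.2 (Set.mem_insert_of_mem _ hB)⟩
  · refine ⟨Set.mem_insert_of_mem _ h'.1, ?_⟩
    rintro B (rfl | hB)
    exacts [h.le, h'.2 hB]

theorem consecutive_empty (A : IsoClass.{u} ℓ) : consecutive A ∅ = ∅ := by
  ext ⟨x, y⟩
  simp only [consecutive, Finset.mem_filter, Finset.mem_product, insert_empty_eq,
    Finset.mem_singleton, Finset.notMem_empty, iff_false]
  rintro ⟨⟨rfl, rfl⟩, h, -⟩
  exact lt_irrefl _ h

/-- The empty chain, admitted exactly when A = C, absorbs the convention S(A, A) = 1, so the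
recursion needs no separate case for B = C. -/
theorem S_eq_sum_extendedChains {A C : IsoClass.{u} ℓ} (h : A ≤ C) :
    S A C = ∑ c ∈ extendedChains A C, subChain A c := by
  rw [S, if_neg (not_not.2 h)]
  split_ifs with hAC
  · subst hAC
    simp [extendedChains_self, subChain, consecutive_empty]
  · rw [extendedChains_of_lt (lt_of_le_of_ne h hAC)]

-- Since B is the least element of {B} ∪ c and A < B, the only new consecutive pair is (A, B).
open Classical in
theorem consecutive_insert {A B : IsoClass.{u} ℓ} {c : Finset (IsoClass.{u} ℓ)} (hAB : A < B)
    (hc : IsAChain B c) :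
    consecutive A (insert B c) = insert (A, B) (consecutive B c) := by
  have hB : ∀ D ∈ insert B c, B ≤ D := by
    intro D hD
    rcases Finset.mem_insert.1 hD with rfl | hD
    exacts [le_rfl, (hc.1 D hD).le]
  ext ⟨x, y⟩
  simp only [consecutive, Finset.mem_filter, Finset.mem_product, Finset.mem_insert (a := (x, y)),
    Prod.mk.injEq]
  constructor
  · rintro ⟨⟨hx, hy⟩, hxy, hmid⟩
    rcases Finset.mem_insert.1 hx with rfl | hxB
    · left
      rcases Finset.mem_insert.1 hy with rfl | hy
      · exact absurd hxy (lt_irrefl _)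
      · refine ⟨rfl, ?_⟩
        by_contra hne
        exact hmid B (by simp) ⟨hAB, lt_of_le_of_ne (hB y hy) (Ne.symm hne)⟩
    · right
      rcases Finset.mem_insert.1 hy with rfl | hy
      · exact absurd (hxy.trans (hAB.trans_le (hB x hxB))) (lt_irrefl _)
      · exact ⟨⟨hxB, hy⟩, hxy, fun D hD => hmid D (Finset.mem_insert_of_mem hD)⟩
  · rintro (⟨rfl, rfl⟩ | ⟨⟨hx, hy⟩, hxy, hmid⟩)
    · refine ⟨by simp, hAB, fun D hD h => ?_⟩
      rcases Finset.mem_insert.1 hD with rfl | hD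
      · exact lt_irrefl _ h.1
      · exact (hB D hD).not_gt h.2
    · refine ⟨⟨Finset.mem_insert_of_mem hx, Finset.mem_insert_of_mem hy⟩, hxy, fun D hD h => ?_⟩
      rcases Finset.mem_insert.1 hD with rfl | hD
      · exact lt_irrefl _ (h.1.trans (hAB.trans_le (hB x hx)))
      · exact hmid D hD h

open Classical in
theorem subChain_insert {A B : IsoClass.{u} ℓ} {c : Finset (IsoClass.{u} ℓ)} (hAB : A < B)
    (hc : IsAChain B c) : subChain A (insert B c) = -((sub A B : ℤ) * subChain B c) := by
  have hBc : B ∉ c := fun h => lt_irrefl _ (hc.1 B h)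
  have hA : (A, B) ∉ consecutive B c := by
    intro h
    simp only [consecutive, Finset.mem_filter, Finset.mem_product] at h
    rcases Finset.mem_insert.1 h.1.1 with h | h
    exacts [hAB.ne h, lt_irrefl _ (hAB.trans (hc.1 A h))]
  rw [subChain, subChain, consecutive_insert hAB hc, Finset.prod_insert hA,
    Finset.card_insert_of_notMem hBc]
  ring

open Classical in
theorem isAChain_insert {A B : IsoClass.{u} ℓ} {c : Finset (IsoClass.{u} ℓ)} (hAB : A < B)
    (hc : IsAChain B c) : IsAChain A (insert B c) := by
  constructor
  · intro D hD
    rcases Finset.mem_insert.1 hD with rfl | hD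
    exacts [hAB, hAB.trans (hc.1 D hD)]
  · rw [Finset.coe_insert]
    exact hc.2.insert fun D hD _ => Or.inl (hc.1 D hD).le

-- B is recovered as the least element of {B} ∪ c.
open Classical in
theorem insert_inj_of_isAChain {B B' : IsoClass.{u} ℓ} {c c' : Finset (IsoClass.{u} ℓ)}
    (hc : IsAChain B c) (hc' : IsAChain B' c') (h : insert B c = insert B' c') :
    B = B' ∧ c = c' := by
  have hB : B = B' := by
    have h1 : B ∈ insert B' c' := h ▸ Finset.mem_insert_self B c
    have h2 : B' ∈ insert B c := h ▸ Finset.mem_insert_self B' c'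
    rcases Finset.mem_insert.1 h1 with h1 | h1
    · exact h1
    rcases Finset.mem_insert.1 h2 with h2 | h2
    · exact h2.symm
    · exact absurd ((hc'.1 B h1).trans (hc.1 B' h2)) (lt_irrefl _)
  subst hB
  refine ⟨rfl, ?_⟩
  rw [← Finset.erase_insert fun h => lt_irrefl _ (hc.1 B h), h,
    Finset.erase_insert fun h => lt_irrefl _ (hc'.1 B h)]

open Classical in
theorem exists_eq_insert_of_isAChain {A : IsoClass.{u} ℓ} {c : Finset (IsoClass.{u} ℓ)}
    (hc : IsAChain A c) (hne : c.Nonempty) :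
    ∃ (B : IsoClass.{u} ℓ) (d : Finset (IsoClass.{u} ℓ)),
      A < B ∧ IsAChain B d ∧ c = insert B d := by
  obtain ⟨B, hB⟩ := c.exists_minimal hne
  refine ⟨B, c.erase B, hc.1 B hB.1, ⟨fun D hD => ?_, hc.2.mono ?_⟩,
    (Finset.insert_erase hB.1).symm⟩
  · obtain ⟨hDB, hD⟩ := Finset.mem_erase.1 hD
    rcases hc.2.total hB.1 hD with h | h
    · exact lt_of_le_of_ne h hDB.symm
    · exact absurd (le_antisymm h (hB.2 hD h)) hDB
  · exact_mod_cast c.erase_subset B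

/-- The recursion for `S` obtained by splitting off the least element of each chain. -/
theorem S_eq_neg_sum {A C : IsoClass.{u} ℓ} (h : A < C) (s : Finset (IsoClass.{u} ℓ))
    (hs : ∀ B, B ∈ s ↔ A < B ∧ B ≤ C) : S A C = -∑ B ∈ s, (sub A B : ℤ) * S B C := by
  classical
  rw [S_eq_sum_extendedChains h.le, extendedChains_of_lt h]
  have hS : ∀ B ∈ s, (sub A B : ℤ) * S B C =
      ∑ c ∈ extendedChains B C, (sub A B : ℤ) * subChain B c := fun B hB => by
    rw [S_eq_sum_extendedChains ((hs B).1 hB).2, Finset.mul_sum]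
  rw [Finset.sum_congr rfl hS, Finset.sum_sigma', ← Finset.sum_neg_distrib]
  symm
  refine Finset.sum_bij (fun p _ => insert p.1 p.2) ?_ ?_ ?_ ?_
  · rintro ⟨B, c⟩ hp
    obtain ⟨hB, hc⟩ := Finset.mem_sigma.1 hp
    obtain ⟨hc, hmax⟩ := mem_extendedChains.1 hc
    rw [Set.Finite.mem_toFinset]
    exact ⟨isAChain_insert ((hs B).1 hB).1 hc, by rwa [Finset.coe_insert]⟩
  · rintro ⟨B, c⟩ hp ⟨B', c'⟩ hp' heq
    obtain ⟨rfl, rfl⟩ := insert_inj_of_isAChain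
      (mem_extendedChains.1 (Finset.mem_sigma.1 hp).2).1
      (mem_extendedChains.1 (Finset.mem_sigma.1 hp').2).1 heq
    rfl
  · intro c hc
    obtain ⟨hc, hmax⟩ := (Set.Finite.mem_toFinset _).1 hc
    obtain ⟨B, d, hAB, hd, rfl⟩ := exists_eq_insert_of_isAChain hc ⟨C, hmax.1⟩
    rw [Finset.coe_insert] at hmax
    exact ⟨⟨B, d⟩, Finset.mem_sigma.2 ⟨(hs B).2 ⟨hAB, hmax.2 (Set.mem_insert _ _)⟩,
      mem_extendedChains.2 ⟨hd, hmax⟩⟩, rfl⟩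
  · rintro ⟨B, c⟩ hp
    obtain ⟨hB, hc⟩ := Finset.mem_sigma.1 hp
    exact (subChain_insert ((hs B).1 hB).1 (mem_extendedChains.1 hc).1).symm

/-! ### S as a sum of Möbius numbers over subgroups -/

theorem of_eq_of {A B : FinAbLGroup.{u} ℓ} : of A = of B ↔ Nonempty (A ≃+ B) :=
  ⟨fun h => Quotient.exact h, fun h => Quotient.sound h⟩

variable {C : FinAbLGroup.{u} ℓ}

theorem of_ofSubgroup_le (H : AddSubgroup C) : of (C.ofSubgroup H) ≤ of C :=
  of_le_of.2 ⟨H.subtype, H.subtype_injective⟩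

theorem of_ofSubgroup_top : of (C.ofSubgroup ⊤) = of C :=
  of_eq_of.2 ⟨AddSubgroup.topEquiv⟩

/-- Nested finite subgroups that are isomorphic have the same order, hence coincide. -/
theorem of_ofSubgroup_lt {H K : AddSubgroup C} (h : H < K) :
    of (C.ofSubgroup H) < of (C.ofSubgroup K) := by
  refine lt_of_le_of_ne (of_le_of.2 ⟨AddSubgroup.inclusion h.le,
    AddSubgroup.inclusion_injective h.le⟩) fun heq => h.ne ?_
  obtain ⟨e⟩ := of_eq_of.1 heq
  exact AddSubgroup.eq_of_le_of_card_ge h.le (Nat.card_congr e.toEquiv).ge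

/-- This moves the count from the subgroups of K into the one lattice of subgroups of C, where the
sums can be exchanged. -/
theorem sub_of_ofSubgroup (A : IsoClass.{u} ℓ) (K : AddSubgroup C) :
    sub A (of (C.ofSubgroup K)) =
      Nat.card {H : AddSubgroup C // H ≤ K ∧ of (C.ofSubgroup H) = A} := by
  obtain ⟨A⟩ := A
  change Nat.card {H : AddSubgroup K // Nonempty (H ≃+ A)} = _
  refine Nat.card_congr ((Equiv.subtypeEquiv (AddSubgroup.MapSubtype.orderIso K).toEquiv
    (q := fun H => of (C.ofSubgroup H.1) = of A) fun H => ?_).trans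
      (Equiv.subtypeSubtypeEquivSubtypeInter (fun H => H ≤ K)
        fun H => of (C.ofSubgroup H) = of A))
  rw [of_eq_of]
  have k : H ≃+ H.map K.subtype := H.equivMapOfInjective _ K.subtype_injective
  exact ⟨fun ⟨g⟩ => ⟨k.symm.trans g⟩, fun ⟨g⟩ => ⟨k.trans g⟩⟩

open Classical in
/-- `S(A, C)` is the sum of the Möbius numbers `μ(H, C)` over the subgroups `H ≅ A` of `C`. -/
theorem S_eq_sum_moebiusTop [Fintype (AddSubgroup C)] {A : IsoClass.{u} ℓ} (hA : A ≤ of C) :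
    S A (of C) = ∑ H : AddSubgroup C with of (C.ofSubgroup H) = A, moebiusTop H := by
  -- Induction downwards from the class of C: the formula is assumed for all larger classes.
  refine (finite_Iic (of C)).wellFoundedOn (r := (· > ·)) |>.induction
    (P := fun A => S A (of C) = ∑ H : AddSubgroup C with of (C.ofSubgroup H) = A, moebiusTop H)
    hA fun A hA ih => ?_
  rcases eq_or_lt_of_le (show A ≤ of C from hA) with rfl | hlt
  · have : (Finset.univ.filter fun H : AddSubgroup C => of (C.ofSubgroup H) = of C) = {⊤} := by
      ext H
      simp only [Finset.mem_filter, Finset.mem_univ, true_and, Finset.mem_singleton]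
      refine ⟨fun h => by_contra fun hH => ?_, fun h => h ▸ of_ofSubgroup_top⟩
      exact (of_ofSubgroup_lt (lt_top_iff_ne_top.2 hH)).ne (h.trans of_ofSubgroup_top.symm)
    rw [this, Finset.sum_singleton, moebiusTop_top, S]
    simp
  · set s : Finset (IsoClass.{u} ℓ) := (finite_Iic (of C)).toFinset.filter (A < ·) with hs
    have hmem : ∀ B, B ∈ s ↔ A < B ∧ B ≤ of C := fun B => by simp [hs, and_comm]
    have hsub (K : AddSubgroup C) : (sub A (of (C.ofSubgroup K)) : ℤ) =
        ∑ H : AddSubgroup C with H ≤ K ∧ of (C.ofSubgroup H) = A, 1 := by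
      rw [sub_of_ofSubgroup, Nat.card_eq_fintype_card, Fintype.card_subtype]
      simp
    calc S A (of C)
        = -∑ B ∈ s, ∑ K : AddSubgroup C with of (C.ofSubgroup K) = B,
            (sub A (of (C.ofSubgroup K)) : ℤ) * moebiusTop K := by
          rw [S_eq_neg_sum hlt s hmem]
          congr 1
          refine Finset.sum_congr rfl fun B hB => ?_
          rw [ih B ((hmem B).1 hB).2 ((hmem B).1 hB).1, Finset.mul_sum]
          refine Finset.sum_congr rfl fun K hK => ?_
          rw [(Finset.mem_filter.1 hK).2]
      _ = -∑ K : AddSubgroup C with of (C.ofSubgroup K) ∈ s,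
            ∑ H : AddSubgroup C with H ≤ K ∧ of (C.ofSubgroup H) = A, moebiusTop K := by
          rw [Finset.sum_fiberwise_eq_sum_filter Finset.univ s fun K => of (C.ofSubgroup K)]
          simp [hsub]
      _ = -∑ H : AddSubgroup C with of (C.ofSubgroup H) = A,
            ∑ K : AddSubgroup C with H < K, moebiusTop K := by
          -- For H ≤ K with H in the class A, the class of K exceeds A exactly when H < K.
          rw [Finset.sum_comm']
          intro K H
          simp only [Finset.mem_filter, Finset.mem_univ, true_and, hmem]
          constructor
          · rintro ⟨⟨h1, -⟩, h2, rfl⟩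
            exact ⟨lt_of_le_of_ne h2 fun h => h1.ne (h ▸ rfl), rfl⟩
          · rintro ⟨h1, rfl⟩
            exact ⟨⟨of_ofSubgroup_lt h1, of_ofSubgroup_le K⟩, h1.le, rfl⟩
      _ = _ := by
          rw [← Finset.sum_neg_distrib]
          refine Finset.sum_congr rfl fun H hH => (moebiusTop_eq_neg_sum ?_).symm
          rintro rfl
          exact hlt.ne ((Finset.mem_filter.1 hH).2.symm.trans of_ofSubgroup_top)

end IsoClass

/-! ### The vanishing theorem -/

theorem mainTheorem2 (ℓ : ℕ) [Fact ℓ.Prime] (hodd : Odd ℓ) (A C : FinAbLGroup.{u} ℓ) (r : ℕ)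
    (hA : A.rank = r) (hC : C.rank = r)
    (h : ¬ ∃ ι : A →+ C, Function.Injective ι ∧ IsElementaryAbelian ℓ (C ⧸ ι.range)) :
    IsoClass.S (IsoClass.of A) (IsoClass.of C) = 0 := by
  classical
  let := Fintype.ofFinite (AddSubgroup C)
  by_cases hAC : IsoClass.of A ≤ IsoClass.of C
  · rw [IsoClass.S_eq_sum_moebiusTop hAC]
    -- It remains to derive the excluded embedding from a subgroup H ≅ A that contains ℓC.
    refine Finset.sum_eq_zero fun H hH => moebiusTop_eq_zero_of_not_le
      (fun K => AddSubgroup.eq_top_of_sup_range_nsmul_eq_top C.isLGroup K) H fun hle => h ?_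
    obtain ⟨e⟩ := IsoClass.of_eq_of.1 (Finset.mem_filter.1 hH).2
    let e' : A ≃+ H := e.symm
    have hrange : (H.subtype.comp e'.toAddMonoidHom).range = H := by
      ext x
      constructor
      · rintro ⟨a, rfl⟩
        exact (e' a).2
      · exact fun hx => ⟨e'.symm ⟨x, hx⟩, by simp⟩
    refine ⟨H.subtype.comp e'.toAddMonoidHom, H.subtype_injective.comp e'.injective, ?_⟩
    rw [hrange]
    intro q
    obtain ⟨x, rfl⟩ := QuotientAddGroup.mk_surjective q
    exact (QuotientAddGroup.eq_zero_iff _).2 (hle ⟨x, rfl⟩)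
  · rw [IsoClass.S, if_pos hAC]
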